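/- **Setting.** Let $\mathcal Z=\mathcal X\times\mathcal Y$ carry a $\sigma$-algebra, let $\nu$ be a probability law on $\mathcal Z$, and let $Z_1,Z_2,\dots$ be i.i.d. random elements of $\mathcal Z$ with law $\nu$, defined on a probability space $(\Omega,\mathcal S,\mathbb P)$; put $S_n=(Z_1,\dots,Z_n)$. Let $\ell:\mathcal Y\times\mathcal Y\to[0,\infty)$ be a loss function, $\mathcal H$ a set of functions $\psi:\mathcal X\to\mathcal Y$, and write $\ell(z,\psi)=\ell(y,\psi(x))$ for $z=(x,y)$. Assume that $z\mapsto\ell(z,\psi)$ is measurable for every $\psi\in\mathcal H$, put $L(\psi)=\int\ell(z,\psi)\,d\nu(z)$ and $C_\ell=\sup_{z\in\mathcal Z,\,\psi\in\mathcal H}\ell(z,\psi)$, and let $$\mathcal A^\star_{\mathcal H,\ell}=\bigl\{\{z\in\mathcal Z:\ell(z,\psi)>b\}:\ \psi\in\mathcal H,\ b\in(0,C_\ell)\bigr\}.$$ The VC dimension $d_{VC}(\mathcal H,\ell)$ is the VC dimension of the class of sets $\mathcal A^\star_{\mathcal H,\ell}$, that is, the greatest integer $n$ with $\sup_{z_1,\dots,z_n}\bigl|\{(\mathbf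 1\{z_1\in A\},\dots,\mathbf 1\{z_n\in A\}):A\in\mathcal A^\star_{\mathcal H,\ell}\}\bigr|=2^n$ ($\infty$ if there are arbitrarily large such $n$). A prediction rule is a family of maps $\Psi_n:\mathcal Z^n\to\mathcal H$, $n\ge1$, such that $(s,z)\mapsto\ell(z,\Psi_n(s))$ is jointly measurable on $\mathcal Z^n\times\mathcal Z$ for every $n$; put $\psi_n=\Psi_n(S_n)$. For every $n$ and every sample $s\in\mathcal Z^n$ let $\mathscr B(s)=\{\beta_{z,\psi,s}:z\in\mathcal Z,\psi\in\mathcal H\}$ be a collection of probability measures on $\mathcal Z$. The $\mathscr B$-generalized resubstitution error is $$\hat\varepsilon_n^{\mathscr B}=\frac1n\sum_{i=1}^n\int_{\mathcal Z}\ell(z',\psi_n)\,d\beta_{Z_i,\psi_n,S_n}(z'),$$ and it is called consistent if $|\hat\varepsilon_n^{\mathscr B}-L(\psi_n)|\to0$ with probability one as $n\to\infty$. **Corollary.** Suppose that $C_\ell<\infty$ (the loss is bounded) and $d_{VC}(\mathcal H,\ell)<\infty$. If $$\sup_{A\in\mathcal A^\star_{\mathcal H,\ell}}\Bigl|\frac1n\sum_{i=1}^n\beta_{Z_i,\psi_n,S_n}(A)-\frac1n\sum_{i=1}^n\delta_{Z_i}(A)\Bigr|\to0$$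 with probability one as $n\to\infty$, then $\hat\varepsilon_n^{\mathscr B}$ is consistent. In particular, if $$\sup_{A\in\mathcal A^\star_{\mathcal H,\ell},\ z\in\mathcal Z,\ \psi\in\mathcal H}\bigl|\beta_{z,\psi,S_n}(A)-\delta_z(A)\bigr|\to0$$ with probability one as $n\to\infty$, then $\hat\varepsilon_n^{\mathscr B}$ is consistent. -/

import Mathlib

open MeasureTheory ProbabilityTheory Filter Topology
open scoped NNReal ENNReal

noncomputable section

namespace GenResub

/-- The `n`-th shatter coefficient of a class `𝒜` of subsets of `Z`: the supremum over
`z₁, …, zₙ` of the number of distinct membership patterns `(1{z₁ ∈ A}, …, 1{zₙ ∈ A})`, `A ∈ 𝒜`. -/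
def shatterCoeff {Z : Type*} (𝒜 : Set (Set Z)) (n : ℕ) : ℕ∞ :=
  ⨆ z : Fin n → Z, Set.encard {v : Fin n → Prop | ∃ A ∈ 𝒜, v = fun i => z i ∈ A}

/-- The VC dimension of a class of sets: the largest `n` with shatter coefficient `2 ^ n`
(`⊤` if there are arbitrarily large such `n`). -/
def vcDim {Z : Type*} (𝒜 : Set (Set Z)) : ℕ∞ :=
  ⨆ (n : ℕ) (_ : shatterCoeff 𝒜 n = 2 ^ n), (n : ℕ∞)

section

variable {X Y : Type*}

/-- The loss `ℓ(z, ψ) = ℓ(y, ψ(x))` of the hypothesis `ψ` at the point `z = (x, y)`. -/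
def lossAt (ℓ : Y → Y → ℝ≥0) (ψ : X → Y) (z : X × Y) : ℝ≥0 := ℓ z.2 (ψ z.1)

/-- The supremum `C_ℓ` of the loss over all points and all hypotheses. -/
def lossSup (ℓ : Y → Y → ℝ≥0) (H : Set (X → Y)) : ℝ≥0∞ :=
  ⨆ (z : X × Y) (ψ : H), (lossAt ℓ ψ z : ℝ≥0∞)

/-- The class of superlevel sets `{z | ℓ(z, ψ) > b}`, `ψ ∈ H`, `0 < b < C_ℓ`. -/
def superlevelSets (ℓ : Y → Y → ℝ≥0) (H : Set (X → Y)) : Set (Set (X × Y)) :=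
  {A | ∃ ψ ∈ H, ∃ b : ℝ≥0, 0 < b ∧ (b : ℝ≥0∞) < lossSup ℓ H ∧ A = {z | b < lossAt ℓ ψ z}}

/-- The VC dimension of the hypothesis space `H` under the loss `ℓ`. -/
def lossVCDim (ℓ : Y → Y → ℝ≥0) (H : Set (X → Y)) : ℕ∞ := vcDim (superlevelSets ℓ H)

/-- A prediction rule: it maps each sample of each size to a hypothesis in `H`. -/
abbrev PredictionRule (H : Set (X → Y)) : Type _ := (n : ℕ) → (Fin n → X × Y) → H

/-- The sample `Sₙ` formed by the first `n` terms of a sequence of data points. -/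
def sample {Ω : Type*} (Z : ℕ → Ω → X × Y) (n : ℕ) (ω : Ω) : Fin n → X × Y := fun i => Z i ω

/- The σ-algebra of the data space `X × Y`; it need not be a product σ-algebra. -/
variable [MeasurableSpace (X × Y)]

/-- A collection of smoothing measures `β_{z, ψ, Sₙ}` for each sample `Sₙ` of each size. -/
abbrev Smoothing (H : Set (X → Y)) : Type _ :=
  (n : ℕ) → (Fin n → X × Y) → X × Y → H → Measure (X × Y)

/-- The expected loss `L(ψ)` of `ψ` under the law `ν`. -/
def risk (ℓ : Y → Y → ℝ≥0) (ν : Measure (X × Y)) (ψ : X → Y) : ℝ :=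
  ∫ z, (lossAt ℓ ψ z : ℝ) ∂ν

/-- The smoothed loss `ℓ_ℬ(z, ψ) = ∫ ℓ(z', ψ) dβ_{z, ψ, Sₙ}(z')`, given the sample `s`. -/
def smoothedLoss (ℓ : Y → Y → ℝ≥0) {H : Set (X → Y)} (β : Smoothing H) {n : ℕ}
    (s : Fin n → X × Y) (z : X × Y) (ψ : H) : ℝ :=
  ∫ z', (lossAt ℓ ψ z' : ℝ) ∂(β n s z ψ)

/-- The generalized resubstitution error of `ψₙ = Ψₙ(Sₙ)`, given the sample `s`. -/
def genResubError (ℓ : Y → Y → ℝ≥0) {H : Set (X → Y)} (Ψ : PredictionRule H) (β : Smoothing H)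
    {n : ℕ} (s : Fin n → X × Y) : ℝ :=
  (1 / (n : ℝ)) * ∑ i, smoothedLoss ℓ β s (s i) (Ψ n s)

/-- The generalized resubstitution error is consistent: its distance to the prediction error
`εₙ = L(ψₙ)` tends to zero with probability one. -/
def IsConsistent {Ω : Type*} [MeasurableSpace Ω] (P : Measure Ω) (Z : ℕ → Ω → X × Y)
    (ν : Measure (X × Y)) (ℓ : Y → Y → ℝ≥0) {H : Set (X → Y)} (Ψ : PredictionRule H)
    (β : Smoothing H) : Prop :=
  ∀ᵐ ω ∂P, Tendsto
    (fun n => |genResubError ℓ Ψ β (sample Z n ω) - risk ℓ ν (Ψ n (sample Z n ω))|) atTop (𝓝 0)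

/-- The supremum over the superlevel sets `A` of
`|(1/n) ∑ᵢ β_{zᵢ, ψₙ, Sₙ}(A) - (1/n) ∑ᵢ δ_{zᵢ}(A)|`, given the sample `s = (z₁, …, zₙ)`. -/
def empiricalGap (ℓ : Y → Y → ℝ≥0) {H : Set (X → Y)} (Ψ : PredictionRule H) (β : Smoothing H)
    {n : ℕ} (s : Fin n → X × Y) : ℝ≥0∞ :=
  ⨆ A ∈ superlevelSets ℓ H, ENNReal.ofReal
    |(1 / (n : ℝ)) * ∑ i, (β n s (s i) (Ψ n s)).real A
      - (1 / (n : ℝ)) * ∑ i, (Measure.dirac (s i)).real A|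

/-- The supremum over the superlevel sets `A`, the points `z` and the hypotheses `ψ` of
`|β_{z, ψ, Sₙ}(A) - δ_z(A)|`, given the sample `s`. -/
def uniformGap (ℓ : Y → Y → ℝ≥0) {H : Set (X → Y)} (β : Smoothing H) {n : ℕ}
    (s : Fin n → X × Y) : ℝ≥0∞ :=
  ⨆ A ∈ superlevelSets ℓ H, ⨆ (z : X × Y) (ψ : H), ENNReal.ofReal
    |(β n s z ψ).real A - (Measure.dirac z).real A|

end

end GenResub

end

/-
The error splits as `(ε̂ₙ - Lₙ) + (Lₙ - L(ψₙ))`, where `Lₙ` is the ordinary resubstitution error of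
`ψₙ`. By the layer cake formula the integral of a loss bounded by `C` is the integral over
`b ∈ (0, C)` of the measure of `{ℓ > b}`, so `|ε̂ₙ - Lₙ|` is at most `C` times the gap between the
empirical measure and its smoothed version on the superlevel sets. For `Lₙ - L(ψₙ)` replace `L(ψₙ)`
by the mean loss of `ψₙ` over an independent ghost sample, at the cost of a factor two in the
probability of a large deviation. Again by the layer cake formula it suffices to compare the two
empirical measures on the superlevel sets. Exchanging the corresponding points of the two samples
by fair coins does not change their joint law, and given the points only polynomially many traces
of superlevel sets matter (Sauer-Shelah), each deviating with exponentially small probability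
(Hoeffding). The resulting tail is summable, and the Borel-Cantelli lemma concludes.
-/

namespace GenResub

open scoped BigOperators

section LayerCake

variable {S ι : Type*} [MeasurableSpace S] {f : S → ℝ} {C : ℝ}

theorem integral_eq_setIntegral_Ioo_measureReal_lt {μ : Measure S} [IsFiniteMeasure μ]
    (hf : AEMeasurable f μ) (hfC : ∀ᵐ z ∂μ, f z ∈ Set.Icc 0 C) :
    ∫ z, f z ∂μ = ∫ t in Set.Ioo 0 C, μ.real {z | t < f z} := by
  rw [(Integrable.of_mem_Icc 0 C hf hfC).integral_eq_integral_meas_lt (hfC.mono fun z hz => hz.1)]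
  refine setIntegral_eq_of_subset_of_forall_sdiff_eq_zero measurableSet_Ioi
    Set.Ioo_subset_Ioi_self fun t ht => ?_
  have hCt : C ≤ t := not_lt.1 fun htC => ht.2 ⟨ht.1, htC⟩
  have hnull : μ {z | t < f z} = 0 := by
    rw [measure_eq_zero_iff_ae_notMem]
    exact hfC.mono fun z hz => not_lt.2 (hz.2.trans hCt)
  simp only [measureReal_def, hnull, ENNReal.toReal_zero]

theorem integrableOn_Ioo_measureReal_lt (μ : Measure S) [IsFiniteMeasure μ] (f : S → ℝ)
    (a b : ℝ) : IntegrableOn (fun t => μ.real {z | t < f z}) (Set.Ioo a b) := by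
  have hanti : Antitone fun t => μ.real {z | t < f z} :=
    fun _ _ hst => measureReal_mono fun _ hz => lt_of_le_of_lt hst hz
  exact Integrable.of_mem_Icc 0 (μ.real Set.univ) hanti.measurable.aemeasurable
    (ae_of_all _ fun _ => ⟨measureReal_nonneg, measureReal_mono (Set.subset_univ _)⟩)

variable [Fintype ι]

theorem expect_integral_eq_setIntegral_Ioo {μ : ι → Measure S} [∀ i, IsFiniteMeasure (μ i)]
    (hf : Measurable f) (hfC : ∀ z, f z ∈ Set.Icc 0 C) :
    𝔼 i, ∫ z, f z ∂μ i = ∫ t in Set.Ioo 0 C, 𝔼 i, (μ i).real {z | t < f z} := by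
  simp only [Fintype.expect_eq_sum_div_card]
  rw [integral_div, integral_finsetSum _ fun i _ => integrableOn_Ioo_measureReal_lt (μ i) f 0 C]
  simp only [integral_eq_setIntegral_Ioo_measureReal_lt hf.aemeasurable (ae_of_all _ hfC)]

theorem abs_expect_integral_sub_le {μ ρ : ι → Measure S} [∀ i, IsFiniteMeasure (μ i)]
    [∀ i, IsFiniteMeasure (ρ i)] (hf : Measurable f) (hC : 0 ≤ C) (hfC : ∀ z, f z ∈ Set.Icc 0 C)
    {η : ℝ} (h : ∀ b ∈ Set.Ioo 0 C,
      |𝔼 i, (μ i).real {z | b < f z} - 𝔼 i, (ρ i).real {z | b < f z}| ≤ η) :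
    |𝔼 i, ∫ z, f z ∂μ i - 𝔼 i, ∫ z, f z ∂ρ i| ≤ C * η := by
  have hint (κ : ι → Measure S) [∀ i, IsFiniteMeasure (κ i)] :
      IntegrableOn (fun t => 𝔼 i, (κ i).real {z | t < f z}) (Set.Ioo 0 C) := by
    simp only [Fintype.expect_eq_sum_div_card]
    exact (integrable_finsetSum _
      fun i _ => integrableOn_Ioo_measureReal_lt (κ i) f 0 C).div_const _
  rw [expect_integral_eq_setIntegral_Ioo hf hfC, expect_integral_eq_setIntegral_Ioo hf hfC,
    ← integral_sub (hint μ) (hint ρ)]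
  simp only [← Real.norm_eq_abs] at h ⊢
  refine (norm_setIntegral_le_of_norm_le_const measure_Ioo_lt_top h).trans_eq ?_
  rw [Real.volume_real_Ioo_of_le hC, sub_zero, mul_comm]

theorem measureReal_dirac {A : Set S} (hA : MeasurableSet A) (z : S) :
    (Measure.dirac z).real A = A.indicator 1 z := by
  by_cases hz : z ∈ A <;> simp [measureReal_def, Measure.dirac_apply' z hA, hz]

theorem abs_expect_sub_expect_le (hf : Measurable f) (hC : 0 ≤ C) (hfC : ∀ z, f z ∈ Set.Icc 0 C)
    {x y : ι → S} {η : ℝ} (h : ∀ b ∈ Set.Ioo 0 C,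
      |𝔼 i, {z | b < f z}.indicator (1 : S → ℝ) (x i) - 𝔼 i, {z | b < f z}.indicator 1 (y i)| ≤ η) :
    |𝔼 i, f (x i) - 𝔼 i, f (y i)| ≤ C * η := by
  have hdirac := abs_expect_integral_sub_le (μ := fun i => .dirac (x i))
    (ρ := fun i => .dirac (y i)) hf hC hfC (η := η)
  simp only [measureReal_dirac (measurableSet_lt measurable_const hf),
    integral_dirac' f _ hf.stronglyMeasurable] at hdirac
  exact hdirac h

end LayerCake

section Hoeffding

variable {Ω ι : Type*} [MeasurableSpace Ω] [Fintype ι] {μ : Measure Ω} [IsProbabilityMeasure μ]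
  {X : ι → Ω → ℝ} {a b ε : ℝ}

theorem measureReal_le_expect_sub_integral_le (hX : iIndepFun X μ)
    (hm : ∀ i, AEMeasurable (X i) μ) (hab : ∀ i, ∀ᵐ ω ∂μ, X i ω ∈ Set.Icc a b) (hε : 0 ≤ ε) :
    μ.real {ω | ε ≤ 𝔼 i, X i ω - 𝔼 i, ∫ ω', X i ω' ∂μ} ≤
      Real.exp (-(2 * Fintype.card ι * ε ^ 2 / (b - a) ^ 2)) := by
  have hindep : iIndepFun (fun i ω => X i ω - ∫ ω', X i ω' ∂μ) μ :=
    hX.comp (fun i x => x - ∫ ω', X i ω' ∂μ) fun i => measurable_id.sub_const _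
  have hsum : ∀ ω, ε ≤ 𝔼 i, X i ω - 𝔼 i, ∫ ω', X i ω' ∂μ →
      Fintype.card ι * ε ≤ ∑ i, (X i ω - ∫ ω', X i ω' ∂μ) := fun ω hω => by
    rw [← Fintype.card_mul_expect, Finset.expect_sub_distrib]
    gcongr
  calc _ ≤ μ.real {ω | Fintype.card ι * ε ≤ ∑ i, (X i ω - ∫ ω', X i ω' ∂μ)} :=
        measureReal_mono hsum
    _ ≤ _ := HasSubgaussianMGF.measure_sum_ge_le_of_iIndepFun hindep
        (fun i _ => hasSubgaussianMGF_of_mem_Icc (hm i) (hab i)) (by positivity)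
    _ = _ := by
      congr 1
      simp only [Finset.sum_const, Finset.card_univ, nsmul_eq_mul, NNReal.coe_mul,
        NNReal.coe_natCast, NNReal.coe_pow, NNReal.coe_div, coe_nnnorm, NNReal.coe_ofNat, div_pow,
        Real.norm_eq_abs, sq_abs]
      rcases eq_or_ne (Fintype.card ι : ℝ) 0 with hn | hn
      · simp [hn]
      · field_simp

theorem measureReal_le_abs_expect_sub_integral_le (hX : iIndepFun X μ)
    (hm : ∀ i, AEMeasurable (X i) μ) (hab : ∀ i, ∀ᵐ ω ∂μ, X i ω ∈ Set.Icc a b) (hε : 0 ≤ ε) :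
    μ.real {ω | ε ≤ |𝔼 i, X i ω - 𝔼 i, ∫ ω', X i ω' ∂μ|} ≤
      2 * Real.exp (-(2 * Fintype.card ι * ε ^ 2 / (b - a) ^ 2)) := by
  have hupper := measureReal_le_expect_sub_integral_le hX hm hab hε
  have hlower := measureReal_le_expect_sub_integral_le
    (hX.comp (fun _ x => -x) fun _ => measurable_neg) (fun i => (hm i).neg)
    (fun i => (hab i).mono fun ω hω => (⟨neg_le_neg hω.2, neg_le_neg hω.1⟩ :
      -X i ω ∈ Set.Icc (-b) (-a))) hε
  simp only [Function.comp_apply, integral_neg, Finset.expect_neg_distrib, neg_sub_neg] at hlower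
  have hcover : {ω | ε ≤ |𝔼 i, X i ω - 𝔼 i, ∫ ω', X i ω' ∂μ|} ⊆
      {ω | ε ≤ 𝔼 i, X i ω - 𝔼 i, ∫ ω', X i ω' ∂μ} ∪
        {ω | ε ≤ 𝔼 i, ∫ ω', X i ω' ∂μ - 𝔼 i, X i ω} := fun ω hω => by
    simpa only [Set.mem_union, Set.mem_ofPred_eq, le_abs, neg_sub] using hω
  calc _ ≤ _ := measureReal_mono hcover
    _ ≤ _ := measureReal_union_le _ _
    _ ≤ _ := (add_le_add hupper hlower).trans_eq (two_mul _).symm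

theorem eventually_measureReal_pi_le_half {S : Type*} [MeasurableSpace S] (ν : Measure S)
    [IsProbabilityMeasure ν] (C : ℝ) (hε : 0 < ε) :
    ∀ᶠ n : ℕ in atTop, ∀ g : S → ℝ, Measurable g → (∀ z, g z ∈ Set.Icc 0 C) →
      (Measure.pi fun _ : Fin n => ν).real {t | ε ≤ |𝔼 i, g (t i) - ∫ z, g z ∂ν|} ≤ 1 / 2 := by
  have htail : Tendsto (fun n : ℕ => 2 * Real.exp (-(2 * n * ε ^ 2 / (|C| + 1 - 0) ^ 2))) atTop
      (𝓝 (2 * 0)) := by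
    refine (Real.tendsto_exp_neg_atTop_nhds_zero.comp ?_).const_mul 2
    simp only [mul_assoc, mul_div_assoc, sub_zero, mul_left_comm (2 : ℝ)]
    exact tendsto_natCast_atTop_atTop.atTop_mul_const (by positivity)
  filter_upwards [htail.eventually_le_const (by norm_num : (2 * 0 : ℝ) < 1 / 2),
    eventually_gt_atTop 0] with n hn hn0 g hg hgC
  have : Nonempty (Fin n) := Fin.pos_iff_nonempty.1 hn0
  have hoeffding := measureReal_le_abs_expect_sub_integral_le (μ := Measure.pi fun _ : Fin n => ν)
    (X := fun i t => g (t i)) (iIndepFun_pi fun _ => hg.aemeasurable)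
    (fun i => (hg.comp (measurable_pi_apply i)).aemeasurable)
    (fun i => ae_of_all _ fun t =>
      Set.Icc_subset_Icc_right (by linarith [le_abs_self C] : C ≤ |C| + 1) (hgC (t i))) hε.le
  simp only [integral_comp_eval (μ := fun _ : Fin n => ν) hg.aestronglyMeasurable,
    Finset.expect_const Finset.univ_nonempty, Fintype.card_fin] at hoeffding
  exact hoeffding.trans hn

end Hoeffding

section Traces

variable {S ι : Type*} [Fintype ι] {𝒜 : Set (Set S)} {d : ℕ}

open Classical in
/-- The sets of indices which the members of a class `𝒜` cut out of the family of points `p`.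
Repeated points are allowed, hence sets of indices rather than sets of points. -/
noncomputable def traces (𝒜 : Set (Set S)) (p : ι → S) : Finset (Finset ι) :=
  {t | ∃ A ∈ 𝒜, (t : Set ι) = p ⁻¹' A}

theorem mem_traces {p : ι → S} {t : Finset ι} :
    t ∈ traces 𝒜 p ↔ ∃ A ∈ 𝒜, (t : Set ι) = p ⁻¹' A := by
  simp only [traces, Finset.mem_filter, Finset.mem_univ, true_and]

theorem toFinset_preimage_mem_traces {A : Set S} (hA : A ∈ 𝒜) (p : ι → S)
    [Fintype (p ⁻¹' A)] : (p ⁻¹' A).toFinset ∈ traces 𝒜 p :=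
  mem_traces.2 ⟨A, hA, Set.coe_toFinset _⟩

theorem le_vcDim_of_forall_exists {n : ℕ} {z : Fin n → S}
    (h : ∀ v : Set (Fin n), ∃ A ∈ 𝒜, z ⁻¹' A = v) : (n : ℕ∞) ≤ vcDim 𝒜 := by
  refine le_iSup₂_of_le n (le_antisymm (iSup_le fun y => ?_) (le_iSup_of_le z ?_)) le_rfl
  · refine (Set.encard_le_encard (Set.subset_univ _)).trans_eq ?_
    simp [Set.encard_univ]
  · have hall : {v : Fin n → Prop | ∃ A ∈ 𝒜, v = fun i => z i ∈ A} = Set.univ :=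
      Set.eq_univ_of_forall fun v => (h v).imp fun A hA => ⟨hA.1, hA.2.symm⟩
    simp [hall, Set.encard_univ]

theorem card_le_vcDim_of_shatters [DecidableEq ι] {p : ι → S} {s : Finset ι}
    (hs : (traces 𝒜 p).Shatters s) : (s.card : ℕ∞) ≤ vcDim 𝒜 := by
  refine le_vcDim_of_forall_exists (z := fun i => p (s.equivFin.symm i)) fun v => ?_
  classical
  obtain ⟨u, hu, hsu⟩ := hs (t := s.filter fun x => ∃ h : x ∈ s, s.equivFin ⟨x, h⟩ ∈ v)
    (Finset.filter_subset _ _)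
  obtain ⟨A, hA, huA⟩ := mem_traces.1 hu
  refine ⟨A, hA, Set.ext fun i => ?_⟩
  have htrace : (s.equivFin.symm i : ι) ∈ u ↔ p (s.equivFin.symm i) ∈ A := Set.ext_iff.1 huA _
  have hpattern := Finset.ext_iff.1 hsu (s.equivFin.symm i)
  simp only [Finset.mem_inter, Finset.coe_mem, true_and, Finset.mem_filter, Subtype.coe_eta,
    Equiv.apply_symm_apply, exists_const] at hpattern
  exact htrace.symm.trans hpattern

theorem vcDim_traces_le [DecidableEq ι] (h𝒜 : vcDim 𝒜 ≤ d) (p : ι → S) :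
    (traces 𝒜 p).vcDim ≤ d :=
  Finset.sup_le fun _ hs =>
    Nat.cast_le.1 ((card_le_vcDim_of_shatters (Finset.mem_shatterer.1 hs)).trans h𝒜)

theorem sum_choose_le_pow (N d : ℕ) : ∑ k ∈ Finset.Iic d, N.choose k ≤ (N + 1) ^ d := by
  rw [add_pow, show Finset.Iic d = Finset.range (d + 1) from by ext; simp]
  refine Finset.sum_le_sum fun k hk => ?_
  have hpos : 0 < d.choose k := Nat.choose_pos (Nat.lt_succ_iff.1 (Finset.mem_range.1 hk))
  rw [one_pow, mul_one]
  exact (Nat.choose_le_pow _ _).trans (Nat.le_mul_of_pos_right _ hpos)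

theorem card_traces_le (h𝒜 : vcDim 𝒜 ≤ d) (p : ι → S) :
    (traces 𝒜 p).card ≤ (Fintype.card ι + 1) ^ d := by
  classical
  calc (traces 𝒜 p).card ≤ (traces 𝒜 p).shatterer.card := Finset.card_le_card_shatterer _
    _ ≤ ∑ k ∈ Finset.Iic (traces 𝒜 p).vcDim, (Fintype.card ι).choose k :=
      Finset.card_shatterer_le_sum_vcDim
    _ ≤ ∑ k ∈ Finset.Iic d, (Fintype.card ι).choose k :=
      Finset.sum_le_sum_of_subset (Finset.Iic_subset_Iic.2 (vcDim_traces_le h𝒜 p))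
    _ ≤ (Fintype.card ι + 1) ^ d := sum_choose_le_pow _ _

end Traces

section RandomSwaps

variable {S ι : Type*} {𝒜 : Set (Set S)} {d : ℕ} {η : ℝ}

/-- The law of a fair coin, deciding whether a pair of sample points is exchanged. -/
noncomputable def fairCoin : Measure Bool := (PMF.uniformOfFintype Bool).toMeasure

instance : IsProbabilityMeasure fairCoin := PMF.toMeasure.isProbabilityMeasure _

theorem integral_fairCoin (g : Bool → ℝ) : ∫ b, g b ∂fairCoin = (g true + g false) / 2 := by
  rw [fairCoin, PMF.integral_eq_sum]
  simp only [Fintype.sum_bool, PMF.uniformOfFintype_apply, Fintype.card_bool, Nat.cast_ofNat,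
    ENNReal.toReal_inv, ENNReal.toReal_ofNat, smul_eq_mul]
  ring

/-- The family of pairs `w` with the entries of the `i`-th pair exchanged whenever the `i`-th coin
shows `false`. -/
def swapPairs (σ : ι → Bool) (w : ι → S × S) (i : ι) : S × S := if σ i then w i else (w i).swap

theorem measurable_swapPairs [MeasurableSpace S] :
    Measurable (Function.uncurry (swapPairs : (ι → Bool) → (ι → S × S) → ι → S × S)) := by
  refine measurable_pi_iff.2 fun i => Measurable.ite ?_ (by fun_prop)
    (measurable_swap.comp (by fun_prop))
  exact (measurableSet_singleton true).preimage
    (f := fun q : (ι → Bool) × (ι → S × S) => q.1 i) (by fun_prop)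

variable [Fintype ι]

theorem measureReal_fairCoin_abs_expect_le {a : ι → ℝ} (ha : ∀ i, |a i| ≤ 1) (hη : 0 ≤ η) :
    (Measure.pi fun _ : ι => fairCoin).real {σ | η ≤ |𝔼 i, if σ i then a i else -a i|} ≤
      2 * Real.exp (-(Fintype.card ι * (η ^ 2 / 2))) := by
  have hmean (i : ι) :
      ∫ σ, (if σ i then a i else -a i) ∂(Measure.pi fun _ : ι => fairCoin) = 0 := by
    rw [integral_comp_eval (μ := fun _ : ι => fairCoin) (f := fun b => if b then a i else -a i)
      (measurable_of_finite _).aestronglyMeasurable, integral_fairCoin]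
    simp
  have hoeffding := measureReal_le_abs_expect_sub_integral_le (a := -1) (b := 1)
    (iIndepFun_pi (μ := fun _ : ι => fairCoin) (X := fun i b => if b then a i else -a i)
      fun _ => (measurable_of_finite _).aemeasurable)
    (fun _ => (measurable_of_finite _).aemeasurable)
    (fun i => ae_of_all _ fun σ => by
      have hai := abs_le.1 (ha i)
      split_ifs <;> constructor <;> linarith) hη
  simp only [hmean, Finset.expect_const_zero, sub_zero] at hoeffding
  refine hoeffding.trans_eq ?_
  congr 3
  ring

theorem measureReal_fairCoin_exists_le (h𝒜 : vcDim 𝒜 ≤ d) (hη : 0 ≤ η) (w : ι → S × S) :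
    (Measure.pi fun _ : ι => fairCoin).real {σ | ∃ A ∈ 𝒜,
      η ≤ |𝔼 i, A.indicator 1 (swapPairs σ w i).1 - 𝔼 i, A.indicator 1 (swapPairs σ w i).2|} ≤
      (2 * Fintype.card ι + 1) ^ d * (2 * Real.exp (-(Fintype.card ι * (η ^ 2 / 2)))) := by
  classical
  let p : ι ⊕ ι → S := Sum.elim (fun i => (w i).1) fun i => (w i).2
  let a (t : Finset (ι ⊕ ι)) (i : ι) : ℝ :=
    (if .inl i ∈ t then 1 else 0) - if .inr i ∈ t then 1 else 0
  have ha (t : Finset (ι ⊕ ι)) (i : ι) : |a t i| ≤ 1 := by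
    simp only [a]
    split_ifs <;> simp
  have hcover : {σ : ι → Bool | ∃ A ∈ 𝒜, η ≤ |𝔼 i, A.indicator (1 : S → ℝ) (swapPairs σ w i).1 -
      𝔼 i, A.indicator 1 (swapPairs σ w i).2|} ⊆
      ⋃ t ∈ traces 𝒜 p, {σ | η ≤ |𝔼 i, if σ i then a t i else -a t i|} := by
    rintro σ ⟨A, hA, hσ⟩
    refine Set.mem_biUnion (toFinset_preimage_mem_traces hA p) (hσ.trans_eq ?_)
    rw [← Finset.expect_sub_distrib]
    congr 1
    refine Finset.expect_congr rfl fun i _ => ?_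
    cases h : σ i <;> simp [a, p, swapPairs, h, Set.indicator_apply]
  calc _ ≤ _ := measureReal_mono hcover (measure_ne_top _ _)
    _ ≤ ∑ t ∈ traces 𝒜 p, _ := measureReal_biUnion_finset_le _ _
    _ ≤ (traces 𝒜 p).card • _ :=
      Finset.sum_le_card_nsmul _ _ _ fun t _ => measureReal_fairCoin_abs_expect_le (ha t) hη
    _ ≤ _ := by
      rw [nsmul_eq_mul]
      gcongr
      exact_mod_cast (card_traces_le h𝒜 p).trans_eq (by rw [Fintype.card_sum, two_mul])

variable [MeasurableSpace S] {ν : Measure S} [IsProbabilityMeasure ν]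

theorem measurePreserving_swapPairs (σ : ι → Bool) :
    MeasurePreserving (swapPairs σ) (Measure.pi fun _ : ι => ν.prod ν)
      (Measure.pi fun _ => ν.prod ν) := by
  refine measurePreserving_pi (f := fun i (x : S × S) => if σ i then x else x.swap) _ _ fun i => ?_
  cases σ i
  · simpa using Measure.measurePreserving_swap
  · exact MeasurePreserving.id _

theorem measureReal_le_of_forall_fairCoin_swapPairs {G : Set (ι → S × S)} (hG : MeasurableSet G)
    {c : ℝ} (hc : 0 ≤ c)
    (h : ∀ w, (Measure.pi fun _ : ι => fairCoin).real {σ | swapPairs σ w ∈ G} ≤ c) :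
    (Measure.pi fun _ : ι => ν.prod ν).real G ≤ c := by
  let τ : Measure (ι → Bool) := Measure.pi fun _ => fairCoin
  let ρ : Measure (ι → S × S) := Measure.pi fun _ => ν.prod ν
  have hR : MeasurableSet (Function.uncurry swapPairs ⁻¹' G) := measurable_swapPairs hG
  refine ENNReal.toReal_le_of_le_ofReal hc ?_
  calc ρ G = ∫⁻ σ, ρ (swapPairs σ ⁻¹' G) ∂τ := by
        simp [ρ, (measurePreserving_swapPairs _).measure_preimage hG.nullMeasurableSet]
    _ = (τ.prod ρ) (Function.uncurry swapPairs ⁻¹' G) := (Measure.prod_apply hR).symm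
    _ = ∫⁻ w, τ {σ | swapPairs σ w ∈ G} ∂ρ := Measure.prod_apply_symm hR
    _ ≤ ∫⁻ _, ENNReal.ofReal c ∂ρ := lintegral_mono fun w =>
      (ENNReal.le_ofReal_iff_toReal_le (measure_ne_top _ _) hc).2 (h w)
    _ = ENNReal.ofReal c := by simp

end RandomSwaps

section GhostSample

theorem mul_measureReal_le_measureReal_prod {α β : Type*} [MeasurableSpace α] [MeasurableSpace β]
    {μ : Measure α} {ν : Measure β} [IsFiniteMeasure μ] [IsFiniteMeasure ν] {E : Set α}
    {G : Set (α × β)} (hG : MeasurableSet G) {c : ℝ} (hc : 0 ≤ c)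
    (h : ∀ x ∈ E, c ≤ ν.real (Prod.mk x ⁻¹' G)) : c * μ.real E ≤ (μ.prod ν).real G :=
  calc c * μ.real E ≤ c * μ.real {x | c ≤ ν.real (Prod.mk x ⁻¹' G)} := by
        gcongr
        · exact measure_ne_top _ _
        · exact h
    _ ≤ ∫ x, ν.real (Prod.mk x ⁻¹' G) ∂μ :=
      mul_meas_ge_le_integral_of_nonneg (ae_of_all _ fun _ => measureReal_nonneg)
        (Measure.integrable_measure_prodMk_left hG (measure_ne_top _ _)) c
    _ = (μ.prod ν).real G := by
      simp only [measureReal_def]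
      rw [Measure.prod_apply hG, integral_toReal (measurable_measure_prodMk_left hG).aemeasurable
        (ae_of_all _ fun _ => measure_lt_top _ _)]

variable {S ι : Type*} [MeasurableSpace S] [Fintype ι] {ν : Measure S} [IsProbabilityMeasure ν]
  {f : (ι → S) → S → ℝ} {C ε η : ℝ} {𝒜 : Set (Set S)} {d : ℕ}

theorem measurableSet_lt_abs_expect_sub (hf : Measurable (Function.uncurry f)) (r : ℝ) :
    MeasurableSet {p : (ι → S) × (ι → S) | r < |𝔼 i, f p.1 (p.1 i) - 𝔼 i, f p.1 (p.2 i)|} := by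
  have hfirst (i : ι) : Measurable fun p : (ι → S) × (ι → S) => f p.1 (p.1 i) :=
    hf.comp (by fun_prop : Measurable fun p : (ι → S) × (ι → S) => (p.1, p.1 i))
  have hsecond (i : ι) : Measurable fun p : (ι → S) × (ι → S) => f p.1 (p.2 i) :=
    hf.comp (by fun_prop : Measurable fun p : (ι → S) × (ι → S) => (p.1, p.2 i))
  simp only [Fintype.expect_eq_sum_div_card]
  exact measurableSet_lt measurable_const
    (((Finset.measurable_fun_sum _ fun i _ => hfirst i).div_const _).sub
      ((Finset.measurable_fun_sum _ fun i _ => hsecond i).div_const _)).abs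

/- Exchanging corresponding entries of the two samples preserves their joint law, so the entries may
be exchanged at random; conditionally on the pairs only finitely many sets of `𝒜` then matter,
although the function `f s` depends on the sample. -/
theorem measureReal_prod_lt_abs_expect_sub_le (hf : Measurable (Function.uncurry f)) (hC : 0 ≤ C)
    (hfC : ∀ s z, f s z ∈ Set.Icc 0 C) (hf𝒜 : ∀ s, ∀ b ∈ Set.Ioo 0 C, {z | b < f s z} ∈ 𝒜)
    (h𝒜 : vcDim 𝒜 ≤ d) (hη : 0 ≤ η) :
    ((Measure.pi fun _ : ι => ν).prod (Measure.pi fun _ => ν)).real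
      {p : (ι → S) × (ι → S) | C * η < |𝔼 i, f p.1 (p.1 i) - 𝔼 i, f p.1 (p.2 i)|} ≤
      (2 * Fintype.card ι + 1) ^ d * (2 * Real.exp (-(Fintype.card ι * (η ^ 2 / 2)))) := by
  have hG := measurableSet_lt_abs_expect_sub hf (C * η)
  have hpairs := measurePreserving_arrowProdEquivProdArrow S S ι (fun _ => ν) fun _ => ν
  rw [← hpairs.measureReal_preimage hG.nullMeasurableSet]
  refine measureReal_le_of_forall_fairCoin_swapPairs (hpairs.measurable hG) (by positivity) fun w =>
    (measureReal_mono fun σ hσ => ?_).trans (measureReal_fairCoin_exists_le h𝒜 hη w)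
  set s : ι → S := fun i => (swapPairs σ w i).1
  have hfar : C * η < |𝔼 i, f s (swapPairs σ w i).1 - 𝔼 i, f s (swapPairs σ w i).2| := hσ
  by_contra hclose
  simp only [Set.mem_ofPred_eq, not_exists, not_and, not_le] at hclose
  exact hfar.not_ge <| abs_expect_sub_expect_le hf.of_uncurry_left hC (hfC s) fun b hb =>
    (hclose _ (hf𝒜 s b hb)).le

theorem measureReal_le_abs_expect_sub_integral_selected_le (hf : Measurable (Function.uncurry f))
    (hC : 0 ≤ C) (hfC : ∀ s z, f s z ∈ Set.Icc 0 C)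
    (hf𝒜 : ∀ s, ∀ b ∈ Set.Ioo 0 C, {z | b < f s z} ∈ 𝒜) (h𝒜 : vcDim 𝒜 ≤ d) (hη : 0 ≤ η)
    (hηε : C * η ≤ ε) (hghost : ∀ s, (Measure.pi fun _ : ι => ν).real
      {t | ε ≤ |𝔼 i, f s (t i) - ∫ z, f s z ∂ν|} ≤ 1 / 2) :
    (Measure.pi fun _ : ι => ν).real {s | 2 * ε ≤ |𝔼 i, f s (s i) - ∫ z, f s z ∂ν|} ≤
      4 * ((2 * Fintype.card ι + 1) ^ d * Real.exp (-(Fintype.card ι * (η ^ 2 / 2)))) := by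
  let π : Measure (ι → S) := Measure.pi fun _ => ν
  have hsection (s : ι → S) (hs : 2 * ε ≤ |𝔼 i, f s (s i) - ∫ z, f s z ∂ν|) :
      1 / 2 ≤ π.real {t | C * η < |𝔼 i, f s (s i) - 𝔼 i, f s (t i)|} := by
    have hcover : Set.univ ⊆ {t : ι → S | ε ≤ |𝔼 i, f s (t i) - ∫ z, f s z ∂ν|} ∪
        {t | C * η < |𝔼 i, f s (s i) - 𝔼 i, f s (t i)|} := fun t _ => by
      by_contra! hfar
      simp only [Set.mem_union, Set.mem_ofPred_eq, not_or, not_le, not_lt] at hfar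
      have htriangle := abs_sub_le (𝔼 i, f s (s i)) (𝔼 i, f s (t i)) (∫ z, f s z ∂ν)
      linarith
    have hone : 1 ≤ π.real _ + π.real _ :=
      calc (1 : ℝ) = π.real Set.univ := probReal_univ.symm
        _ ≤ _ := measureReal_mono hcover
        _ ≤ _ := measureReal_union_le _ _
    linarith [hghost s]
  have hsymm := mul_measureReal_le_measureReal_prod (μ := π)
    (E := {s | 2 * ε ≤ |𝔼 i, f s (s i) - ∫ z, f s z ∂ν|})
    (measurableSet_lt_abs_expect_sub hf (C * η)) one_half_pos.le hsection
  have htail := measureReal_prod_lt_abs_expect_sub_le (ν := ν) hf hC hfC hf𝒜 h𝒜 hη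
  linarith [hsymm.trans htail]

end GhostSample

section AlmostSure

variable {Ω : Type*} [MeasurableSpace Ω] {P : Measure Ω}

theorem ae_tendsto_zero_of_summable_measureReal [IsFiniteMeasure P] {Y : ℕ → Ω → ℝ}
    (hY : ∀ ε > 0, Summable fun n => P.real {ω | ε ≤ |Y n ω|}) :
    ∀ᵐ ω ∂P, Tendsto (fun n => Y n ω) atTop (𝓝 0) := by
  have hsmall (k : ℕ) : ∀ᵐ ω ∂P, ∀ᶠ n in atTop, |Y n ω| < 1 / (k + 1) := by
    have hBorelCantelli := ae_eventually_notMem (μ := P)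
      (s := fun n => {ω | (1 / (k + 1) : ℝ) ≤ |Y n ω|})
      (by simpa using (hY (1 / (k + 1)) (by positivity)).tsum_ofReal_ne_top)
    simpa only [Set.mem_ofPred_eq, not_le] using hBorelCantelli
  filter_upwards [ae_all_iff.2 hsmall] with ω hω
  refine Metric.nhds_basis_ball_inv_nat_succ.tendsto_right_iff.2 fun k _ => ?_
  simpa only [mem_ball_zero_iff, Real.norm_eq_abs] using hω k

theorem summable_two_mul_add_one_pow_mul_exp_neg (d : ℕ) {c : ℝ} (hc : 0 < c) :
    Summable fun n : ℕ => (2 * n + 1 : ℝ) ^ d * Real.exp (-(n * c)) := by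
  have hshift := ((summable_nat_add_iff 1).2 (Real.summable_pow_mul_exp_neg_nat_mul d hc)).mul_left
    (2 ^ d * Real.exp c)
  refine hshift.of_nonneg_of_le (fun n => by positivity) fun n => ?_
  calc (2 * n + 1 : ℝ) ^ d * Real.exp (-(n * c))
      ≤ (2 * (n + 1)) ^ d * Real.exp (c + -c * (n + 1)) := by
        gcongr <;> linarith
    _ = _ := by rw [mul_pow, Real.exp_add]; push_cast; ring

variable {S : Type*} [MeasurableSpace S] {ν : Measure S} [IsProbabilityMeasure ν]

theorem ae_tendsto_expect_sub_integral_selected [IsProbabilityMeasure P] {Z : ℕ → Ω → S}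
    (hZ : ∀ i, HasLaw (Z i) ν P) (hZindep : iIndepFun Z P) {f : (n : ℕ) → (Fin n → S) → S → ℝ}
    (hf : ∀ n, Measurable (Function.uncurry (f n))) {C : ℝ} (hC : 0 ≤ C)
    (hfC : ∀ n s z, f n s z ∈ Set.Icc 0 C) {𝒜 : Set (Set S)}
    (hf𝒜 : ∀ n s, ∀ b ∈ Set.Ioo 0 C, {z | b < f n s z} ∈ 𝒜) (h𝒜 : vcDim 𝒜 < ⊤) :
    ∀ᵐ ω ∂P, Tendsto (fun n => 𝔼 i : Fin n, f n (fun i => Z i ω) (Z i ω) -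
      ∫ z, f n (fun i => Z i ω) z ∂ν) atTop (𝓝 0) := by
  obtain ⟨d, hd⟩ := ENat.ne_top_iff_exists.1 h𝒜.ne
  refine ae_tendsto_zero_of_summable_measureReal fun ε hε => ?_
  obtain ⟨η, hη, hηε⟩ := exists_pos_mul_lt (half_pos hε) C
  refine Summable.of_norm_bounded_eventually_nat
    ((summable_two_mul_add_one_pow_mul_exp_neg d (half_pos (pow_pos hη 2))).mul_left 4) ?_
  filter_upwards [eventually_measureReal_pi_le_half ν C (half_pos hε)] with n hn
  have hsample := (hZindep.precomp Fin.val_injective).hasLaw_pi fun i : Fin n => hZ i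
  have htail := measureReal_le_abs_expect_sub_integral_selected_le (hf n) hC (hfC n) (hf𝒜 n)
    hd.ge hη.le hηε.le fun s => hn (f n s) (hf n).of_uncurry_left (hfC n s)
  rw [mul_div_cancel₀ _ two_ne_zero, Fintype.card_fin, ← hsample.map_eq] at htail
  rw [Real.norm_of_nonneg measureReal_nonneg]
  exact (ENNReal.toReal_mono (measure_ne_top _ _)
    (Measure.le_map_apply hsample.aemeasurable _)).trans htail

end AlmostSure

section Loss

variable {X Y : Type*} {ℓ : Y → Y → ℝ≥0} {H : Set (X → Y)}

theorem lossAt_mem_Icc (hbdd : lossSup ℓ H < ⊤) (ψ : H) (z : X × Y) :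
    (lossAt ℓ ψ z : ℝ) ∈ Set.Icc 0 (lossSup ℓ H).toReal :=
  ⟨NNReal.coe_nonneg _, ENNReal.toReal_mono hbdd.ne (le_iSup₂_of_le z ψ le_rfl)⟩

theorem setOf_lt_lossAt_mem_superlevelSets (hbdd : lossSup ℓ H < ⊤) (ψ : H) {b : ℝ}
    (hb : b ∈ Set.Ioo 0 (lossSup ℓ H).toReal) :
    {z | b < lossAt ℓ ψ z} ∈ superlevelSets ℓ H := by
  lift b to ℝ≥0 using hb.1.le
  have hbC : (b : ℝ≥0∞) < lossSup ℓ H :=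
    (ENNReal.toReal_lt_toReal ENNReal.coe_ne_top hbdd.ne).1 hb.2
  exact ⟨ψ, ψ.2, b, NNReal.coe_pos.1 hb.1, hbC, by simp only [NNReal.coe_lt_coe]⟩

theorem one_div_mul_sum_eq_expect {n : ℕ} (a : Fin n → ℝ) : 1 / (n : ℝ) * ∑ i, a i = 𝔼 i, a i := by
  rw [Fintype.expect_eq_sum_div_card, Fintype.card_fin, one_div_mul_eq_div]

variable [MeasurableSpace (X × Y)] {Ψ : PredictionRule H} {β : Smoothing H} {n : ℕ}

theorem abs_expect_sub_expect_le_empiricalGap {s : Fin n → X × Y}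
    (hgap : empiricalGap ℓ Ψ β s ≠ ⊤) {A : Set (X × Y)} (hA : A ∈ superlevelSets ℓ H) :
    |𝔼 i, (β n s (s i) (Ψ n s)).real A - 𝔼 i, (Measure.dirac (s i)).real A| ≤
      (empiricalGap ℓ Ψ β s).toReal := by
  simp only [← one_div_mul_sum_eq_expect]
  exact (ENNReal.ofReal_le_iff_le_toReal hgap).1 (le_iSup₂_of_le A hA le_rfl)

theorem empiricalGap_le_uniformGap (s : Fin n → X × Y) :
    empiricalGap ℓ Ψ β s ≤ uniformGap ℓ β s := by
  refine iSup₂_mono fun A _ => ?_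
  rw [one_div_mul_sum_eq_expect, one_div_mul_sum_eq_expect, ← Finset.expect_sub_distrib]
  rcases isEmpty_or_nonempty (Fin n)
  · simp
  obtain ⟨i, -, hi⟩ := Finset.exists_le_of_le_expect Finset.univ_nonempty
    (Finset.abs_expect_le Finset.univ fun i : Fin n =>
      (β n s (s i) (Ψ n s)).real A - (Measure.dirac (s i)).real A)
  exact le_iSup₂_of_le (s i) (Ψ n s) (ENNReal.ofReal_le_ofReal hi)

theorem abs_genResubError_sub_expect_le (hbdd : lossSup ℓ H < ⊤) {s : Fin n → X × Y}
    (hψ : Measurable (lossAt ℓ (Ψ n s : X → Y))) (hβ : ∀ i, IsFiniteMeasure (β n s (s i) (Ψ n s)))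
    (hgap : empiricalGap ℓ Ψ β s ≠ ⊤) :
    |genResubError ℓ Ψ β s - 𝔼 i, (lossAt ℓ (Ψ n s) (s i) : ℝ)| ≤
      (lossSup ℓ H).toReal * (empiricalGap ℓ Ψ β s).toReal := by
  have hlayer := abs_expect_integral_sub_le (μ := fun i => β n s (s i) (Ψ n s))
    (ρ := fun i => .dirac (s i)) hψ.coe_nnreal_real ENNReal.toReal_nonneg
    (lossAt_mem_Icc hbdd (Ψ n s)) fun _ hb => abs_expect_sub_expect_le_empiricalGap hgap
      (setOf_lt_lossAt_mem_superlevelSets hbdd (Ψ n s) hb)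
  simpa only [genResubError, smoothedLoss, one_div_mul_sum_eq_expect,
    integral_dirac' _ _ hψ.coe_nnreal_real.stronglyMeasurable] using hlayer

theorem tendsto_genResubError_sub_expect (hbdd : lossSup ℓ H < ⊤)
    (hΨ : ∀ n s, Measurable (lossAt ℓ (Ψ n s : X → Y)))
    (hβ : ∀ n s z ψ, IsFiniteMeasure (β n s z ψ))
    {s : (n : ℕ) → Fin n → X × Y}
    (hgap : Tendsto (fun n => empiricalGap ℓ Ψ β (s n)) atTop (𝓝 0)) :
    Tendsto (fun n => genResubError ℓ Ψ β (s n) - 𝔼 i, (lossAt ℓ (Ψ n (s n)) (s n i) : ℝ))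
      atTop (𝓝 0) := by
  have hbound : Tendsto (fun n => (lossSup ℓ H).toReal * (empiricalGap ℓ Ψ β (s n)).toReal) atTop
      (𝓝 0) := by
    simpa using ((ENNReal.tendsto_toReal ENNReal.zero_ne_top).comp hgap).const_mul
      (lossSup ℓ H).toReal
  refine squeeze_zero_norm' ?_ hbound
  filter_upwards [hgap.eventually_ne ENNReal.zero_ne_top] with n hn
  exact abs_genResubError_sub_expect_le hbdd (hΨ n _) (fun _ => hβ n _ _ _) hn

end Loss

end GenResub

theorem corollary3_general {X Y Ω : Type*} [MeasurableSpace (X × Y)] [MeasurableSpace Ω]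
    (P : Measure Ω) [IsProbabilityMeasure P] (ν : Measure (X × Y)) [IsProbabilityMeasure ν]
    (Z : ℕ → Ω → X × Y) (hZ : ∀ i, HasLaw (Z i) ν P) (hZindep : iIndepFun Z P)
    (ℓ : Y → Y → ℝ≥0) (H : Set (X → Y)) (hbdd : GenResub.lossSup ℓ H < ⊤)
    (hVC : GenResub.lossVCDim ℓ H < ⊤) (Ψ : GenResub.PredictionRule H)
    (hΨ : ∀ n, Measurable
      (fun p : (Fin n → X × Y) × (X × Y) => GenResub.lossAt ℓ (Ψ n p.1) p.2))
    (β : GenResub.Smoothing H) (hβ : ∀ n s z ψ, IsFiniteMeasure (β n s z ψ)) :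
    ((∀ᵐ ω ∂P, Tendsto (fun n => GenResub.empiricalGap ℓ Ψ β (GenResub.sample Z n ω))
        atTop (𝓝 0)) →
      GenResub.IsConsistent P Z ν ℓ Ψ β) ∧
    ((∀ᵐ ω ∂P, Tendsto (fun n => GenResub.uniformGap ℓ β (GenResub.sample Z n ω))
        atTop (𝓝 0)) →
      GenResub.IsConsistent P Z ν ℓ Ψ β) := by
  open GenResub in
  have hLLN := ae_tendsto_expect_sub_integral_selected hZ hZindep
    (f := fun n s z => (lossAt ℓ (Ψ n s : X → Y) z : ℝ)) (fun n => (hΨ n).coe_nnreal_real)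
    ENNReal.toReal_nonneg (fun n s => lossAt_mem_Icc hbdd (Ψ n s))
    (fun n s _ => setOf_lt_lossAt_mem_superlevelSets hbdd (Ψ n s)) hVC
  have hempirical (hgap : ∀ᵐ ω ∂P,
      Tendsto (fun n => empiricalGap ℓ Ψ β (sample Z n ω)) atTop (𝓝 0)) :
      IsConsistent P Z ν ℓ Ψ β := by
    filter_upwards [hgap, hLLN] with ω hω hlln
    have hsmooth := tendsto_genResubError_sub_expect hbdd
      (fun n _ => (hΨ n).comp measurable_prodMk_left) hβ hω
    have htotal := (hsmooth.add hlln).abs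
    rw [add_zero, abs_zero] at htotal
    exact htotal.congr fun n => congrArg abs (sub_add_sub_cancel _ _ _)
  refine ⟨hempirical, fun hgap => hempirical ?_⟩
  filter_upwards [hgap] with ω hω
  exact tendsto_of_tendsto_of_tendsto_of_le_of_le tendsto_const_nhds hω (fun _ => zero_le)
    fun n => empiricalGap_le_uniformGap _

theorem corollary3 {X Y Ω : Type*} [MeasurableSpace (X × Y)] [MeasurableSpace Ω]
    -- the i.i.d. data with law `ν`
    (P : Measure Ω) [IsProbabilityMeasure P] (ν : Measure (X × Y)) [IsProbabilityMeasure ν]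
    (Z : ℕ → Ω → X × Y) (hZmeas : ∀ i, Measurable (Z i)) (hZindep : iIndepFun Z P)
    (hZlaw : ∀ i, P.map (Z i) = ν)
    -- the loss and the hypothesis space
    (ℓ : Y → Y → ℝ≥0) (H : Set (X → Y))
    (hmeas : ∀ ψ ∈ H, Measurable (GenResub.lossAt ℓ ψ))
    (hbdd : GenResub.lossSup ℓ H < ⊤)
    (hVC : GenResub.lossVCDim ℓ H < ⊤)
    -- the prediction rule, measurable in the sample and the point jointly
    (Ψ : GenResub.PredictionRule H)
    (hΨ : ∀ n, Measurable
      (fun p : (Fin n → X × Y) × (X × Y) => GenResub.lossAt ℓ (Ψ n p.1) p.2))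
    -- the smoothing measures
    (β : GenResub.Smoothing H) (hβ : ∀ n s z ψ, IsProbabilityMeasure (β n s z ψ)) :
    ((∀ᵐ ω ∂P, Tendsto (fun n => GenResub.empiricalGap ℓ Ψ β (GenResub.sample Z n ω))
        atTop (𝓝 0)) →
      GenResub.IsConsistent P Z ν ℓ Ψ β) ∧
    ((∀ᵐ ω ∂P, Tendsto (fun n => GenResub.uniformGap ℓ β (GenResub.sample Z n ω))
        atTop (𝓝 0)) →
      GenResub.IsConsistent P Z ν ℓ Ψ β) :=
  corollary3_general P ν Z (fun i => ⟨(hZmeas i).aemeasurable, hZlaw i⟩) hZindep ℓ H hbdd hVC Ψ hΨ β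
    fun n s z ψ => have := hβ n s z ψ; inferInstance
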